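/- \textbf{Proposition.} There exists an absolute constant $C > 0$ such that the following holds. Let $N, n$ be positive integers. Let $A$ be an $N \times n$ random matrix (defined on some probability space) whose entries $a_{ij}$ are independent real random variables with $\mathbb{E}\, a_{ij} = 0$ and $\mathbb{E}\, a_{ij}^4 \le 1$ for all $i, j$; the entries need not be identically distributed. Let $B$ be a non-random real $n \times N$ matrix with $\|B\| \le 1$. Then $\|BA\|$ is integrable and $$ \mathbb{E} \|BA\| \le C \sqrt{n \log (2n)}. $$ Here $\|\cdot\|$ denotes the spectral norm of a matrix, i.e. the $\ell_2 \to \ell_2$ operator norm $\|W\| = \sup_{x \neq 0} \|Wx\|_2/\|x\|_2$. In particular, the bound does not depend on $N$. -/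

import Mathlib

open MeasureTheory ProbabilityTheory

-- The norm `‖M‖` of a rectangular matrix is the spectral norm, i.e. the `ℓ₂ → ℓ₂` operator norm.
open scoped Matrix.Norms.L2Operator

/-! The second moment E‖BA‖² is shown to be of order n log(2n). Let y_j = B a_j be the columns of
BA. They are independent, and ‖BA‖² = ‖S‖ with S = ∑ y_j y_jᵀ.

The mean is harmless: E S = B (E AAᵀ) Bᵀ with E AAᵀ diagonal and entries at most n. For the
deviation, fix signs s. The columns with sign + are independent of those with sign −, so two
applications of Jensen give E‖S − E S‖ ≤ 4 E‖∑ s_j y_j y_jᵀ‖. Averaging over s and applying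
Rudelson's inequality, a case of matrix Khintchine, bounds the right side by a multiple of E (p R
‖BA‖²)^{1/2}, where p is about log(2n) and R dominates all |y_j|². By AM-GM this is a small multiple
of E‖BA‖², absorbed on the left, plus a multiple of p E R.

It remains that E R = O(n). Fourth moments give |y_j|² ≤ n + W_j with E W_j² ≤ 8n, and the maximum
of n such W_j has mean O(n). Only ‖B‖ and the n rows of B enter, so N disappears. -/

/-! ### Matrix Khintchine by trace moments and sign flips. -/

section MatrixKhintchine

open Matrix

variable {m : Type*} [Fintype m] [DecidableEq m]

theorem Matrix.IsHermitian.exists_unitary_pow_eq {X : Matrix m m ℝ} (hX : X.IsHermitian) :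
    ∃ U ∈ unitary (Matrix m m ℝ), ∃ d : m → ℝ,
      ∀ q : ℕ, X ^ q = U * diagonal (fun k => d k ^ q) * star U := by
  refine ⟨hX.eigenvectorUnitary, hX.eigenvectorUnitary.2, hX.eigenvalues, fun q => ?_⟩
  have h := hX.spectral_theorem
  conv_lhs => rw [h, ← map_pow, diagonal_pow]
  rw [Unitary.conjStarAlgAut_apply]
  rfl

/-- In eigenbases of the two Hermitian matrices the trace is a combination of scalars with
nonnegative weights, so trace inequalities reduce to scalar ones. -/
theorem trace_mul_pow_mul_pow_eq {A X Y U V : Matrix m m ℝ} {d e : m → ℝ} (hA : A.IsHermitian)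
    {q r : ℕ} (hX : X ^ q = U * diagonal (fun k => d k ^ q) * star U)
    (hY : Y ^ r = V * diagonal (fun k => e k ^ r) * star V) :
    (A * X ^ q * A * Y ^ r).trace =
      ∑ k, ∑ l, ((star U * A * V) k l) ^ 2 * (d k ^ q * e l ^ r) := by
  have hC : star (star U * A * V) = star V * A * U := by
    simp only [star_mul, star_star, mul_assoc]
    rw [show star A = A from hA]
  have h1 : (A * X ^ q * A * Y ^ r).trace =
      (diagonal (fun k => d k ^ q) * (star U * A * V) * diagonal (fun k => e k ^ r) *
        star (star U * A * V)).trace := by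
    rw [hC, hX, hY]
    have : A * (U * diagonal (fun k => d k ^ q) * star U) * A *
        (V * diagonal (fun k => e k ^ r) * star V) =
        (A * U) * (diagonal (fun k => d k ^ q) * (star U * A * V) * diagonal (fun k => e k ^ r)
          * star V) := by simp only [mul_assoc]
    rw [this, trace_mul_comm]
    simp only [mul_assoc]
  rw [h1]
  generalize star U * A * V = C
  simp only [trace, diag_apply, mul_apply (M := diagonal (fun k => d k ^ q) * C * _),
    mul_diagonal, diagonal_mul, star_apply, star_trivial]
  exact Finset.sum_congr rfl fun k _ => Finset.sum_congr rfl fun l _ => by ring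

/-- The differences |a|^q − |b|^q and |a|^r − |b|^r have the same sign, so their product is
nonnegative. -/
theorem pow_mul_pow_add_le (a b : ℝ) (q r p : ℕ) (h : q + r = 2 * p) :
    a ^ q * b ^ r + a ^ r * b ^ q ≤ a ^ (2 * p) + b ^ (2 * p) := by
  have key : |a| ^ q * |b| ^ r + |a| ^ r * |b| ^ q ≤ |a| ^ (2 * p) + |b| ^ (2 * p) := by
    rw [← h, pow_add, pow_add]
    rcases le_total |a| |b| with hab | hab
    · nlinarith [mul_nonneg (sub_nonneg.2 (pow_le_pow_left₀ (abs_nonneg a) hab q))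
        (sub_nonneg.2 (pow_le_pow_left₀ (abs_nonneg a) hab r))]
    · nlinarith [mul_nonneg (sub_nonneg.2 (pow_le_pow_left₀ (abs_nonneg b) hab q))
        (sub_nonneg.2 (pow_le_pow_left₀ (abs_nonneg b) hab r))]
  have ha : |a| ^ (2 * p) = a ^ (2 * p) := by rw [pow_mul, pow_mul, sq_abs]
  have hb : |b| ^ (2 * p) = b ^ (2 * p) := by rw [pow_mul, pow_mul, sq_abs]
  rw [ha, hb] at key
  refine le_trans (add_le_add ?_ ?_) key
  · exact (le_abs_self _).trans (by rw [abs_mul, abs_pow, abs_pow])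
  · exact (le_abs_self _).trans (by rw [abs_mul, abs_pow, abs_pow])

theorem trace_mul_pow_mul_pow_add_le {A X Y : Matrix m m ℝ} (hA : A.IsHermitian)
    (hX : X.IsHermitian) (hY : Y.IsHermitian) {q r p : ℕ} (h : q + r = 2 * p) :
    (A * X ^ q * A * Y ^ r).trace + (A * X ^ r * A * Y ^ q).trace ≤
      (A * A * X ^ (2 * p)).trace + (A * A * Y ^ (2 * p)).trace := by
  obtain ⟨U, -, d, hd⟩ := hX.exists_unitary_pow_eq
  obtain ⟨V, -, e, he⟩ := hY.exists_unitary_pow_eq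
  have e1 : (A * A * X ^ (2 * p)).trace = (A * X ^ (2 * p) * A * Y ^ 0).trace := by
    rw [pow_zero, mul_one, trace_mul_comm (A * X ^ _), mul_assoc]
  have e2 : (A * A * Y ^ (2 * p)).trace = (A * X ^ 0 * A * Y ^ (2 * p)).trace := by
    rw [pow_zero, mul_one]
  rw [e1, e2, trace_mul_pow_mul_pow_eq hA (hd _) (he _), trace_mul_pow_mul_pow_eq hA (hd _) (he _),
    trace_mul_pow_mul_pow_eq hA (hd _) (he _), trace_mul_pow_mul_pow_eq hA (hd _) (he _),
    ← Finset.sum_add_distrib, ← Finset.sum_add_distrib]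
  refine Finset.sum_le_sum fun k _ => ?_
  rw [← Finset.sum_add_distrib, ← Finset.sum_add_distrib]
  refine Finset.sum_le_sum fun l _ => ?_
  rw [← mul_add, ← mul_add]
  refine mul_le_mul_of_nonneg_left ?_ (sq_nonneg _)
  simpa using pow_mul_pow_add_le (d k) (e l) q r p h

theorem pow_sub_pow_eq_sum {R : Type*} [Ring R] (x y : R) (k : ℕ) :
    x ^ k - y ^ k = ∑ q ∈ Finset.range k, x ^ q * (x - y) * y ^ (k - 1 - q) := by
  induction k with
  | zero => simp
  | succ k ih =>
    rw [Finset.sum_range_succ]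
    have : ∀ q ∈ Finset.range k, x ^ q * (x - y) * y ^ (k + 1 - 1 - q) =
        x ^ q * (x - y) * y ^ (k - 1 - q) * y := fun q hq => by
      rw [Finset.mem_range] at hq
      rw [mul_assoc _ _ y, ← pow_succ]
      congr 2
      omega
    rw [Finset.sum_congr rfl this, ← Finset.sum_mul, ← ih]
    simp [pow_succ, sub_mul, mul_sub]

/-- The telescoping expansion of the difference of powers turns the left side into a sum of mixed
traces. Pairing q with 2p − q lets each pair be bounded by the two pure traces. -/
theorem trace_mul_pow_sub_pow_le {A X Y : Matrix m m ℝ} (hA : A.IsHermitian)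
    (hX : X.IsHermitian) (hY : Y.IsHermitian) {c : ℝ} (hXY : X - Y = (2 * c) • A) (p : ℕ)
    (hc : c * c = 1) :
    c * (A * (X ^ (2 * p + 1) - Y ^ (2 * p + 1))).trace ≤
      (2 * p + 1) * ((A * A * X ^ (2 * p)).trace + (A * A * Y ^ (2 * p)).trace) := by
  have h1 : c * (A * (X ^ (2 * p + 1) - Y ^ (2 * p + 1))).trace =
      2 * ∑ q ∈ Finset.range (2 * p + 1), (A * X ^ q * A * Y ^ (2 * p - q)).trace := by
    rw [pow_sub_pow_eq_sum, hXY, Finset.mul_sum, trace_sum, Finset.mul_sum, Finset.mul_sum]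
    refine Finset.sum_congr rfl fun q _ => ?_
    simp only [mul_smul_comm, smul_mul_assoc, trace_smul, smul_eq_mul, add_tsub_cancel_right,
      mul_assoc]
    linear_combination 2 * (A * (X ^ q * (A * Y ^ (2 * p - q)))).trace * hc
  have h2 := Finset.sum_range_reflect
    (fun q => (A * X ^ q * A * Y ^ (2 * p - q)).trace) (2 * p + 1)
  have h3 : ∑ q ∈ Finset.range (2 * p + 1), ((A * X ^ q * A * Y ^ (2 * p - q)).trace +
      (A * X ^ (2 * p - q) * A * Y ^ q).trace) ≤ ∑ q ∈ Finset.range (2 * p + 1),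
        ((A * A * X ^ (2 * p)).trace + (A * A * Y ^ (2 * p)).trace) :=
    Finset.sum_le_sum fun q hq => trace_mul_pow_mul_pow_add_le hA hX hY (by
      rw [Finset.mem_range] at hq; omega)
  have h4 : ∑ q ∈ Finset.range (2 * p + 1), (A * X ^ (2 * p - q) * A * Y ^ q).trace =
      ∑ q ∈ Finset.range (2 * p + 1), (A * X ^ q * A * Y ^ (2 * p - q)).trace := by
    rw [← h2]
    refine Finset.sum_congr rfl fun q hq => ?_
    rw [Finset.mem_range] at hq
    rw [show 2 * p + 1 - 1 - q = 2 * p - q by omega, show 2 * p - (2 * p - q) = q by omega]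
  rw [Finset.sum_add_distrib, h4, Finset.sum_const, Finset.card_range, nsmul_eq_mul] at h3
  rw [h1]
  push_cast at h3
  linarith

/-- The signed sum of a family of matrices. -/
def signedSum {ι : Type*} [Fintype ι] {E : Type*} [AddCommGroup E] [Module ℝ E] (Y : ι → E)
    (s : ι → ℤˣ) : E :=
  ∑ j, ((s j : ℤ) : ℝ) • Y j

theorem signedSum_isHermitian {ι k : Type*} [Fintype ι] {Y : ι → Matrix k k ℝ}
    (hY : ∀ j, (Y j).IsHermitian) (s : ι → ℤˣ) : (signedSum Y s).IsHermitian := by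
  unfold signedSum IsHermitian
  rw [conjTranspose_sum]
  exact Finset.sum_congr rfl fun j _ => by rw [conjTranspose_smul, hY j, star_trivial]

theorem signedSum_sub_flip {ι : Type*} [Fintype ι] [DecidableEq ι] {E : Type*} [AddCommGroup E]
    [Module ℝ E] (Y : ι → E) (s : ι → ℤˣ) (j : ι) :
    signedSum Y s - signedSum Y (s * Pi.mulSingle j (-1)) = (2 * ((s j : ℤ) : ℝ)) • Y j := by
  unfold signedSum
  rw [← Finset.sum_sub_distrib, Finset.sum_eq_single j]
  · simp [two_mul, add_smul]
  · intro i _ hi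
    simp [Pi.mulSingle_eq_of_ne hi]
  · simp

/-- A discrete integration by parts: one factor of the power is expanded, and for each j the sign
patterns are compared with those having the j-th sign flipped. -/
theorem sum_trace_signedSum_pow_succ_le {ι : Type*} [Fintype ι] [DecidableEq ι] {Y : ι → Matrix m m ℝ}
    (hY : ∀ j, (Y j).IsHermitian) {v : ℝ}
    (hv : ∀ z : m → ℝ, z ⬝ᵥ (∑ j, Y j * Y j) *ᵥ z ≤ v * (z ⬝ᵥ z)) (p : ℕ) :
    ∑ s, (signedSum Y s ^ (2 * (p + 1))).trace ≤
      (2 * p + 1) * v * ∑ s, (signedSum Y s ^ (2 * p)).trace := by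
  have hflip : ∀ j, ∑ s, ((s j : ℤ) : ℝ) * (Y j * signedSum Y s ^ (2 * p + 1)).trace ≤
      (2 * p + 1) * ∑ s, (Y j * Y j * signedSum Y s ^ (2 * p)).trace := fun j => by
    let e := Equiv.mulRight (Pi.mulSingle j (-1) : ι → ℤˣ)
    have h1 := Equiv.sum_comp e
      (fun s : ι → ℤˣ => ((s j : ℤ) : ℝ) * (Y j * signedSum Y s ^ (2 * p + 1)).trace)
    have h2 := Equiv.sum_comp e
      (fun s : ι → ℤˣ => (Y j * Y j * signedSum Y s ^ (2 * p)).trace)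
    have h3 := Finset.sum_le_sum fun (s : ι → ℤˣ) (_ : s ∈ Finset.univ) =>
      trace_mul_pow_sub_pow_le (hY j) (signedSum_isHermitian hY s)
        (signedSum_isHermitian hY (e s)) (signedSum_sub_flip Y s j) p
        (by rcases Int.units_eq_one_or (s j) with h | h <;> simp [h])
    have h4 : ∀ s : ι → ℤˣ, (((e s) j : ℤ) : ℝ) = -((s j : ℤ) : ℝ) := fun s => by simp [e]
    simp only [h4, neg_mul, Finset.sum_neg_distrib] at h1
    simp only [mul_sub, trace_sub, Finset.sum_sub_distrib, ← Finset.mul_sum,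
      Finset.sum_add_distrib] at h3
    rw [h2] at h3
    linarith
  have hV : ∀ s, ((∑ j, Y j * Y j) * signedSum Y s ^ (2 * p)).trace ≤
      v * (signedSum Y s ^ (2 * p)).trace := fun s => by
    -- The even power is Z Zᵀ, so its trace against a matrix is a sum of quadratic forms over the
    -- columns of Z, where `hv` applies.
    set Z := signedSum Y s ^ p with hZ
    have hZt : Zᵀ = Z := by
      have := (signedSum_isHermitian hY s).pow p
      rwa [IsHermitian, conjTranspose_eq_transpose_of_trivial] at this
    have hZZ : signedSum Y s ^ (2 * p) = Z * Z := by rw [two_mul, pow_add]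
    have h5 : ∀ M : Matrix m m ℝ, (M * (Z * Z)).trace = ∑ k, (fun i => Z i k) ⬝ᵥ M *ᵥ
        (fun i => Z i k) := fun M => by
      rw [← mul_assoc, trace_mul_comm]
      refine Finset.sum_congr rfl fun k _ => ?_
      rw [diag_apply, mul_apply]
      refine Finset.sum_congr rfl fun i _ => ?_
      have : Z k i = Z i k := congrFun (congrFun hZt i) k
      rw [this]
      rfl
    rw [hZZ, h5, ← one_mul (Z * Z), h5, Finset.mul_sum]
    simp only [one_mulVec]
    exact Finset.sum_le_sum fun k _ => hv _
  calc ∑ s, (signedSum Y s ^ (2 * (p + 1))).trace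
      = ∑ j, ∑ s, ((s j : ℤ) : ℝ) * (Y j * signedSum Y s ^ (2 * p + 1)).trace := by
        rw [Finset.sum_comm]
        refine Finset.sum_congr rfl fun s _ => ?_
        rw [show 2 * (p + 1) = (2 * p + 1) + 1 by ring, pow_succ']
        conv_lhs => enter [1, 1]; rw [signedSum]
        rw [Finset.sum_mul, trace_sum]
        simp
    _ ≤ ∑ j, (2 * p + 1) * ∑ s, (Y j * Y j * signedSum Y s ^ (2 * p)).trace :=
        Finset.sum_le_sum fun j _ => hflip j
    _ = (2 * p + 1) * ∑ s, ((∑ j, Y j * Y j) * signedSum Y s ^ (2 * p)).trace := by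
        rw [← Finset.mul_sum, Finset.sum_comm]
        simp only [Finset.sum_mul, trace_sum]
    _ ≤ (2 * p + 1) * ∑ s, v * (signedSum Y s ^ (2 * p)).trace :=
        mul_le_mul_of_nonneg_left (Finset.sum_le_sum fun s _ => hV s) (by positivity)
    _ = _ := by rw [← Finset.mul_sum, mul_assoc]

/-- Every factor 2p + 1 of the recursion is replaced by the fixed 2P, which makes the induction a
geometric bound. -/
theorem sum_trace_signedSum_pow_le {ι : Type*} [Fintype ι] [DecidableEq ι] {Y : ι → Matrix m m ℝ}
    (hY : ∀ j, (Y j).IsHermitian) {v : ℝ} (hv0 : 0 ≤ v)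
    (hv : ∀ z : m → ℝ, z ⬝ᵥ (∑ j, Y j * Y j) *ᵥ z ≤ v * (z ⬝ᵥ z)) (P p : ℕ) (hp : p ≤ P) :
    ∑ s, (signedSum Y s ^ (2 * p)).trace ≤
      (2 * P * v) ^ p * (Fintype.card m * Fintype.card (ι → ℤˣ)) := by
  induction p with
  | zero => simp [mul_comm]
  | succ p ih =>
    refine (sum_trace_signedSum_pow_succ_le hY hv p).trans ?_
    rw [pow_succ', mul_assoc (2 * (P : ℝ) * v)]
    have hP : (p : ℝ) + 1 ≤ P := by exact_mod_cast hp
    refine (mul_le_mul_of_nonneg_left (ih (by omega)) (by positivity)).trans ?_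
    exact mul_le_mul_of_nonneg_right (mul_le_mul_of_nonneg_right (by linarith) hv0) (by positivity)

theorem norm_pow_le_trace_pow {X : Matrix m m ℝ} (hX : X.IsHermitian) (p : ℕ) (hp : 0 < p) :
    ‖X‖ ^ (2 * p) ≤ (X ^ (2 * p)).trace := by
  obtain ⟨U, hU, d, hd⟩ := hX.exists_unitary_pow_eq
  have ht : (X ^ (2 * p)).trace = ∑ k, d k ^ (2 * p) := by
    rw [hd, trace_mul_comm, ← mul_assoc, (Unitary.mem_iff.1 hU).1, one_mul, trace_diagonal]
  have hn : ‖X‖ = ‖d‖ := by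
    have := hd 1
    simp only [pow_one] at this
    rw [this, CStarRing.norm_mul_mem_unitary _ (Unitary.star_mem hU),
      CStarRing.norm_mem_unitary_mul _ hU, l2_opNorm_diagonal]
  have hnn : ∀ k, 0 ≤ d k ^ (2 * p) := fun k => by rw [pow_mul]; positivity
  rw [ht, hn]
  rcases isEmpty_or_nonempty m with h | h
  · simp [Subsingleton.elim d 0, hp.ne']
  · obtain ⟨k, hk⟩ := Finite.exists_max (fun k => ‖d k‖)
    have : ‖d‖ = ‖d k‖ :=
      le_antisymm ((pi_norm_le_iff_of_nonneg (norm_nonneg _)).2 hk) (norm_le_pi_norm d k)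
    rw [this, pow_mul, Real.norm_eq_abs, sq_abs, ← pow_mul]
    exact Finset.single_le_sum (f := fun k => d k ^ (2 * p)) (fun k _ => hnn k)
      (Finset.mem_univ k)

/-- **Matrix Khintchine inequality** for Rademacher sums of Hermitian matrices. -/
theorem sum_norm_signedSum_sq_le {ι : Type*} [Fintype ι] [DecidableEq ι] {Y : ι → Matrix m m ℝ}
    (hY : ∀ j, (Y j).IsHermitian) {v : ℝ} (hv0 : 0 ≤ v)
    (hv : ∀ z : m → ℝ, z ⬝ᵥ (∑ j, Y j * Y j) *ᵥ z ≤ v * (z ⬝ᵥ z)) (p : ℕ) (hp : 0 < p)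
    (hm : (Fintype.card m : ℝ) ≤ Real.exp p) :
    ((∑ s, ‖signedSum Y s‖) / Fintype.card (ι → ℤˣ)) ^ 2 ≤ 6 * p * v := by
  set K : ℝ := ((Fintype.card (ι → ℤˣ) : ℕ) : ℝ) with hK
  have hK0 : 0 < K := by rw [hK]; exact_mod_cast Fintype.card_pos
  have h1 := Real.pow_arith_mean_le_arith_mean_pow Finset.univ (fun _ : ι → ℤˣ => K⁻¹)
    (fun s => ‖signedSum Y s‖) (fun _ _ => by positivity)
    (by rw [Finset.sum_const, nsmul_eq_mul, Finset.card_univ, ← hK, mul_inv_cancel₀ hK0.ne'])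
    (fun _ _ => norm_nonneg _) (2 * p)
  rw [← Finset.mul_sum, ← Finset.mul_sum, inv_mul_eq_div, inv_mul_eq_div, pow_mul] at h1
  refine le_of_pow_le_pow_left₀ hp.ne' (by positivity) (h1.trans ?_)
  rw [div_le_iff₀ hK0]
  calc ∑ s, ‖signedSum Y s‖ ^ (2 * p) ≤ ∑ s, (signedSum Y s ^ (2 * p)).trace :=
        Finset.sum_le_sum fun s _ => norm_pow_le_trace_pow (signedSum_isHermitian hY s) p hp
    _ ≤ (2 * p * v) ^ p * (Fintype.card m * K) :=
        sum_trace_signedSum_pow_le hY hv0 hv p p le_rfl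
    -- The dimension costs only a factor 3 after the p-th root, because it is at most exp p.
    _ ≤ (2 * p * v) ^ p * (3 ^ p * K) := by
        gcongr
        refine hm.trans ?_
        rw [← mul_one (p : ℝ), Real.exp_nat_mul]
        gcongr
        exact Real.exp_one_lt_three.le
    _ = (6 * p * v) ^ p * K := by rw [← mul_assoc, ← mul_pow]; ring_nf

end MatrixKhintchine

/-! ### Rank-one sums and Rudelson's inequality. -/

section Rudelson

open Matrix

theorem dotProduct_self_vecMul_le {m ι : Type*} [Fintype m] [DecidableEq m] [Fintype ι]
    [DecidableEq ι] (M : Matrix m ι ℝ) (z : m → ℝ) :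
    (z ᵥ* M) ⬝ᵥ (z ᵥ* M) ≤ ‖M‖ ^ 2 * (z ⬝ᵥ z) := by
  have h := l2_opNorm_mulVec Mᴴ (WithLp.toLp 2 z)
  rw [l2_opNorm_conjTranspose] at h
  have h2 := pow_le_pow_left₀ (norm_nonneg _) h 2
  rw [mul_pow, EuclideanSpace.norm_sq_eq, EuclideanSpace.norm_sq_eq] at h2
  simp only [conjTranspose_eq_transpose_of_trivial, mulVec_transpose, Real.norm_eq_abs,
    sq_abs] at h2
  simp only [dotProduct, ← sq]
  exact h2

theorem sum_vecMulVec_col_eq {m ι : Type*} [Fintype ι] (M : Matrix m ι ℝ) :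
    ∑ j, vecMulVec (M.col j) (M.col j) = M * Mᵀ := by
  ext k l
  simp [Matrix.sum_apply, vecMulVec_apply, mul_apply]

theorem norm_sum_vecMulVec_col {m ι : Type*} [Fintype m] [DecidableEq m] [Fintype ι]
    [DecidableEq ι] (M : Matrix m ι ℝ) :
    ‖∑ j, vecMulVec (M.col j) (M.col j)‖ = ‖M‖ ^ 2 := by
  have h := l2_opNorm_conjTranspose_mul_self Mᴴ
  rw [conjTranspose_conjTranspose, l2_opNorm_conjTranspose, ← sq,
    conjTranspose_eq_transpose_of_trivial] at h
  rw [sum_vecMulVec_col_eq, h]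

/-- **Rudelson's inequality** for Rademacher sums of rank-one matrices. -/
theorem sum_norm_signedSum_vecMulVec_sq_le {m ι : Type*} [Fintype m] [DecidableEq m] [Fintype ι]
    [DecidableEq ι] (M : Matrix m ι ℝ) {R : ℝ} (hR0 : 0 ≤ R)
    (hR : ∀ j, M.col j ⬝ᵥ M.col j ≤ R) (p : ℕ) (hp : 0 < p)
    (hm : (Fintype.card m : ℝ) ≤ Real.exp p) :
    ((∑ s, ‖signedSum (fun j => vecMulVec (M.col j) (M.col j)) s‖) /
      (Fintype.card (ι → ℤˣ) : ℝ)) ^ 2 ≤ 6 * p * (R * ‖M‖ ^ 2) := by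
  refine sum_norm_signedSum_sq_le (fun j => ?_) (by positivity) (fun z => ?_) p hp hm
  · rw [IsHermitian, conjTranspose_eq_transpose_of_trivial, transpose_vecMulVec]
  -- Since (y yᵀ)² = |y|² y yᵀ, the variance matrix is dominated by R M Mᵀ.
  · have h1 : z ⬝ᵥ (∑ j, vecMulVec (M.col j) (M.col j) * vecMulVec (M.col j) (M.col j)) *ᵥ z =
        ∑ j, (M.col j ⬝ᵥ M.col j) * (z ⬝ᵥ M.col j) ^ 2 := by
      rw [sum_mulVec, dotProduct_sum]
      refine Finset.sum_congr rfl fun j _ => ?_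
      rw [vecMulVec_mul_vecMulVec, vecMulVec_mulVec]
      simp only [dotProduct_smul, smul_dotProduct, smul_eq_mul, MulOpposite.smul_eq_mul_unop,
        MulOpposite.unop_op, dotProduct_comm (M.col j) z]
      ring
    have h2 : ∑ j, (z ⬝ᵥ M.col j) ^ 2 = (z ᵥ* M) ⬝ᵥ (z ᵥ* M) := by
      simp only [dotProduct, vecMul, sq]
      rfl
    rw [h1]
    calc ∑ j, (M.col j ⬝ᵥ M.col j) * (z ⬝ᵥ M.col j) ^ 2
        ≤ ∑ j, R * (z ⬝ᵥ M.col j) ^ 2 :=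
          Finset.sum_le_sum fun j _ => mul_le_mul_of_nonneg_right (hR j) (sq_nonneg _)
      _ = R * ((z ᵥ* M) ⬝ᵥ (z ᵥ* M)) := by rw [← Finset.mul_sum, h2]
      _ ≤ R * (‖M‖ ^ 2 * (z ⬝ᵥ z)) :=
          mul_le_mul_of_nonneg_left (dotProduct_self_vecMul_le M z) hR0
      _ = _ := by ring

end Rudelson

/-! ### Symmetrization without an independent copy. -/

section Symmetrization

variable {Ω 𝒰 𝒱 E : Type*} [MeasurableSpace Ω] [MeasurableSpace 𝒰] [MeasurableSpace 𝒱]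
  [NormedAddCommGroup E] [NormedSpace ℝ E] [CompleteSpace E]
  {μ : Measure Ω} [IsProbabilityMeasure μ] {U : Ω → 𝒰} {V : Ω → 𝒱} {F : 𝒰 → E} {G : 𝒱 → E}

/-- Jensen's inequality in the second variable, for each fixed value of the first, followed by
Fubini. -/
theorem ProbabilityTheory.IndepFun.integral_norm_le_integral_norm_add (hUV : IndepFun U V μ)
    (hU : Measurable U) (hV : Measurable V) (hF : StronglyMeasurable F) (hG : StronglyMeasurable G)
    (hFU : Integrable (fun ω => F (U ω)) μ) (hGV : Integrable (fun ω => G (V ω)) μ)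
    (h0 : ∫ ω, G (V ω) ∂μ = 0) :
    ∫ ω, ‖F (U ω)‖ ∂μ ≤ ∫ ω, ‖F (U ω) + G (V ω)‖ ∂μ := by
  have hα : IsProbabilityMeasure (μ.map U) := Measure.isProbabilityMeasure_map hU.aemeasurable
  have hβ : IsProbabilityMeasure (μ.map V) := Measure.isProbabilityMeasure_map hV.aemeasurable
  have hlaw := (indepFun_iff_map_prod_eq_prod_map_map hU.aemeasurable hV.aemeasurable).1 hUV
  have hF' : Integrable F (μ.map U) :=
    (integrable_map_measure hF.aestronglyMeasurable hU.aemeasurable).2 hFU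
  have hG' : Integrable G (μ.map V) :=
    (integrable_map_measure hG.aestronglyMeasurable hV.aemeasurable).2 hGV
  have hG0 : ∫ y, G y ∂(μ.map V) = 0 := by
    rw [integral_map hV.aemeasurable hG.aestronglyMeasurable, h0]
  have hint : Integrable (fun z : 𝒰 × 𝒱 => ‖F z.1 + G z.2‖) ((μ.map U).prod (μ.map V)) :=
    ((hF'.comp_fst _).add (hG'.comp_snd _)).norm
  have h1 : ∫ ω, ‖F (U ω) + G (V ω)‖ ∂μ =
      ∫ z, ‖F z.1 + G z.2‖ ∂((μ.map U).prod (μ.map V)) := by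
    rw [← hlaw, integral_map (hU.prodMk hV).aemeasurable]
    rw [hlaw]
    exact hint.aestronglyMeasurable
  have h2 : ∫ ω, ‖F (U ω)‖ ∂μ = ∫ x, ‖F x‖ ∂(μ.map U) := by
    rw [integral_map hU.aemeasurable hF.norm.aestronglyMeasurable]
  rw [h1, h2, integral_prod _ hint]
  refine integral_mono hF'.norm hint.integral_prod_left fun x => ?_
  calc ‖F x‖ = ‖∫ y, (F x + G y) ∂(μ.map V)‖ := by
        rw [integral_add (integrable_const _) hG', hG0]
        simp
    _ ≤ ∫ y, ‖F x + G y‖ ∂(μ.map V) := norm_integral_le_integral_norm _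

theorem ProbabilityTheory.IndepFun.integral_norm_add_le_two_mul_integral_norm_sub
    (hUV : IndepFun U V μ)
    (hU : Measurable U) (hV : Measurable V) (hF : StronglyMeasurable F) (hG : StronglyMeasurable G)
    (hFU : Integrable (fun ω => F (U ω)) μ) (hGV : Integrable (fun ω => G (V ω)) μ)
    (hF0 : ∫ ω, F (U ω) ∂μ = 0) (hG0 : ∫ ω, G (V ω) ∂μ = 0) :
    ∫ ω, ‖F (U ω) + G (V ω)‖ ∂μ ≤ 2 * ∫ ω, ‖F (U ω) - G (V ω)‖ ∂μ := by
  have h1 := hUV.integral_norm_le_integral_norm_add hU hV hF hG.neg hFU hGV.neg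
    (by simp [integral_neg, hG0])
  have h2 := hUV.symm.integral_norm_le_integral_norm_add hV hU hG hF.neg hGV hFU.neg
    (by simp [integral_neg, hF0])
  simp only [Pi.neg_apply, ← sub_eq_add_neg] at h1 h2
  simp only [norm_sub_rev (G _)] at h2
  calc ∫ ω, ‖F (U ω) + G (V ω)‖ ∂μ ≤ ∫ ω, (‖F (U ω)‖ + ‖G (V ω)‖) ∂μ :=
        integral_mono (hFU.add hGV).norm (hFU.norm.add hGV.norm) fun ω => norm_add_le _ _
    _ = ∫ ω, ‖F (U ω)‖ ∂μ + ∫ ω, ‖G (V ω)‖ ∂μ := integral_add hFU.norm hGV.norm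
    _ ≤ _ := by linarith

/-- After centering, one factor 2 comes from the mean-zero case. The other comes from removing the
means f and g again, since ‖f − g‖ is itself at most E‖F − G‖. -/
theorem ProbabilityTheory.IndepFun.integral_norm_add_sub_integral_le (hUV : IndepFun U V μ)
    (hU : Measurable U) (hV : Measurable V) (hF : StronglyMeasurable F) (hG : StronglyMeasurable G)
    (hFU : Integrable (fun ω => F (U ω)) μ) (hGV : Integrable (fun ω => G (V ω)) μ) :
    ∫ ω, ‖F (U ω) + G (V ω) - ∫ ω', (F (U ω') + G (V ω')) ∂μ‖ ∂μ ≤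
      4 * ∫ ω, ‖F (U ω) - G (V ω)‖ ∂μ := by
  set f := ∫ ω, F (U ω) ∂μ with hf
  set g := ∫ ω, G (V ω) ∂μ with hg
  have h1 := hUV.integral_norm_add_le_two_mul_integral_norm_sub hU hV
    (hF.sub (stronglyMeasurable_const (b := f))) (hG.sub (stronglyMeasurable_const (b := g)))
    (hFU.sub (integrable_const f)) (hGV.sub (integrable_const g))
    (by simp only [Pi.sub_apply, integral_sub hFU (integrable_const f)]; simp [hf])
    (by simp only [Pi.sub_apply, integral_sub hGV (integrable_const g)]; simp [hg])
  simp only [Pi.sub_apply] at h1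
  have h2 : ∫ ω, ‖F (U ω) - f - (G (V ω) - g)‖ ∂μ ≤
      ∫ ω, (‖F (U ω) - G (V ω)‖ + ‖f - g‖) ∂μ :=
    integral_mono ((hFU.sub (integrable_const f)).sub (hGV.sub (integrable_const g))).norm
      ((hFU.sub hGV).norm.add (integrable_const _)) fun ω => by
        change ‖F (U ω) - f - (G (V ω) - g)‖ ≤ ‖F (U ω) - G (V ω)‖ + ‖f - g‖
        rw [sub_sub_sub_comm]
        exact norm_sub_le _ _
  have h3 : ‖f - g‖ ≤ ∫ ω, ‖F (U ω) - G (V ω)‖ ∂μ := by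
    rw [hf, hg, ← integral_sub hFU hGV]
    exact norm_integral_le_integral_norm _
  have hFG : Integrable (fun ω => ‖F (U ω) - G (V ω)‖) μ := (hFU.sub hGV).norm
  rw [integral_add hFG (integrable_const _)] at h2
  simp only [integral_const, probReal_univ, one_smul] at h2
  rw [integral_add hFU hGV, ← hf, ← hg]
  simp only [add_sub_add_comm]
  linarith

end Symmetrization

/-- Padding with zeros keeps both blocks in the same function space, so no subtypes occur later. -/
theorem ProbabilityTheory.iIndepFun.indepFun_ite {Ω κ : Type*} [MeasurableSpace Ω] [Fintype κ]
    {μ : Measure Ω} {a : κ → Ω → ℝ} (ha : iIndepFun a μ)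
    (hm : ∀ i, Measurable (a i)) (q : κ → Prop) [DecidablePred q] :
    IndepFun (fun ω i => if q i then a i ω else 0) (fun ω i => if q i then 0 else a i ω) μ := by
  classical
  have h := ha.indepFun_finset (Finset.univ.filter q) (Finset.univ.filter fun i => ¬ q i)
    (Finset.disjoint_filter_filter_not _ _ _) hm
  have h2 := h.comp
    (φ := fun x i => if hi : i ∈ Finset.univ.filter q then x ⟨i, hi⟩ else 0)
    (ψ := fun x i => if hi : i ∈ Finset.univ.filter (fun i => ¬ q i) then x ⟨i, hi⟩ else 0)
    (measurable_pi_lambda _ fun i => by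
      by_cases hi : i ∈ Finset.univ.filter q
      · simpa only [hi, dite_true] using measurable_pi_apply _
      · simp only [hi, dite_false, measurable_const])
    (measurable_pi_lambda _ fun i => by
      by_cases hi : i ∈ Finset.univ.filter (fun i => ¬ q i)
      · simpa only [hi, dite_true] using measurable_pi_apply _
      · simp only [hi, dite_false, measurable_const])
  convert h2 using 1
  · ext ω i
    by_cases hi : q i <;> simp [hi]
  · ext ω i
    by_cases hi : q i <;> simp [hi]

/-! ### Consequences of a finite fourth moment. -/

section SecondMoment

variable {Ω : Type*} [MeasurableSpace Ω] {μ : Measure Ω}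

theorem memLp_two_mul_of_integrable_pow_four {f g : Ω → ℝ} (hf : Measurable f) (hg : Measurable g)
    (hf4 : Integrable (fun ω => f ω ^ 4) μ) (hg4 : Integrable (fun ω => g ω ^ 4) μ) :
    MemLp (fun ω => f ω * g ω) 2 μ := by
  rw [memLp_two_iff_integrable_sq (f := fun ω => f ω * g ω) (hf.mul hg).aestronglyMeasurable]
  refine (hf4.add hg4).mono' ((hf.mul hg).pow_const 2).aestronglyMeasurable
    (Filter.Eventually.of_forall fun ω => ?_)
  rw [Real.norm_eq_abs, abs_of_nonneg (sq_nonneg _)]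
  simp only [Pi.add_apply]
  nlinarith [sq_nonneg (f ω ^ 2 - g ω ^ 2), sq_nonneg (f ω ^ 2), sq_nonneg (g ω ^ 2)]

variable [IsProbabilityMeasure μ]

theorem memLp_two_of_integrable_pow_four {f : Ω → ℝ} (hf : Measurable f)
    (hf4 : Integrable (fun ω => f ω ^ 4) μ) : MemLp f 2 μ := by
  simpa using memLp_two_mul_of_integrable_pow_four hf (measurable_const (a := (1 : ℝ))) hf4
    (by simp)

theorem integral_sq_sub_integral_sq_sq_eq {f : Ω → ℝ} (hf : Measurable f)
    (hf4 : Integrable (fun ω => f ω ^ 4) μ) :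
    ∫ ω, (f ω ^ 2 - ∫ ω', f ω' ^ 2 ∂μ) ^ 2 ∂μ =
      ∫ ω, f ω ^ 4 ∂μ - (∫ ω, f ω ^ 2 ∂μ) ^ 2 := by
  set σ := ∫ ω, f ω ^ 2 ∂μ with hσ
  have h2 : Integrable (fun ω => f ω ^ 2) μ :=
    (memLp_two_of_integrable_pow_four hf hf4).integrable_sq
  have : ∀ ω, (f ω ^ 2 - σ) ^ 2 = f ω ^ 4 - 2 * σ * f ω ^ 2 + σ ^ 2 := fun ω => by ring
  have h3 : Integrable (fun ω => f ω ^ 4 - 2 * σ * f ω ^ 2) μ := hf4.sub (h2.const_mul _)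
  simp only [this]
  rw [integral_add h3 (integrable_const _),
    integral_sub hf4 (h2.const_mul _), integral_const_mul, ← hσ]
  simp
  ring

theorem integral_sq_le_one_of_integral_pow_four_le_one {f : Ω → ℝ} (hf : Measurable f)
    (hf4 : Integrable (fun ω => f ω ^ 4) μ) (hle : ∫ ω, f ω ^ 4 ∂μ ≤ 1) :
    ∫ ω, f ω ^ 2 ∂μ ≤ 1 := by
  have h := integral_sq_sub_integral_sq_sq_eq hf hf4
  have h2 : 0 ≤ ∫ ω, (f ω ^ 2 - ∫ ω', f ω' ^ 2 ∂μ) ^ 2 ∂μ := integral_nonneg fun _ => sq_nonneg _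
  nlinarith

end SecondMoment

/-! ### Variance of the squared norm of a random combination. -/

section CenteredSquareNorm

open scoped InnerProductSpace

variable {Ω ι H : Type*} [MeasurableSpace Ω] {μ : Measure Ω} [IsProbabilityMeasure μ]
  [NormedAddCommGroup H] [InnerProductSpace ℝ H]

/-- The squared norm of `∑ i ∈ s, x i • b i`, minus its mean for uncorrelated coordinates `x i`
of second moment `v i`. -/
def centeredSqNorm (b : ι → H) (v : ι → ℝ) (s : Finset ι) (x : ι → ℝ) : ℝ :=
  ‖∑ i ∈ s, x i • b i‖ ^ 2 - ∑ i ∈ s, v i * ‖b i‖ ^ 2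

theorem centeredSqNorm_insert [DecidableEq ι] (b : ι → H) (v : ι → ℝ) {s : Finset ι} {t : ι}
    (ht : t ∉ s) (x : ι → ℝ) :
    centeredSqNorm b v (insert t s) x = centeredSqNorm b v s x +
      (2 * (x t * ∑ i ∈ s, ⟪b t, b i⟫_ℝ * x i) + ‖b t‖ ^ 2 * (x t ^ 2 - v t)) := by
  have h : ⟪x t • b t, ∑ i ∈ s, x i • b i⟫_ℝ = x t * ∑ i ∈ s, ⟪b t, b i⟫_ℝ * x i := by
    rw [real_inner_smul_left, inner_sum]
    congr 1
    exact Finset.sum_congr rfl fun i _ => by rw [real_inner_smul_right, mul_comm]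
  unfold centeredSqNorm
  rw [Finset.sum_insert ht, Finset.sum_insert ht, norm_add_sq_real, h, norm_smul, mul_pow,
    Real.norm_eq_abs, sq_abs]
  ring

theorem measurable_centeredSqNorm [Fintype ι] (b : ι → H) (v : ι → ℝ) (s : Finset ι) :
    Measurable (centeredSqNorm b v s) := by
  refine Continuous.measurable ?_
  unfold centeredSqNorm
  fun_prop

theorem integral_sq_sum_mul_le {a : ι → Ω → ℝ} (ha : iIndepFun a μ)
    (hm : ∀ i, Measurable (a i)) (h0 : ∀ i, ∫ ω, a i ω ∂μ = 0)
    (h2 : ∀ i, MemLp (a i) 2 μ) (hle : ∀ i, ∫ ω, a i ω ^ 2 ∂μ ≤ 1)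
    (g : ι → ℝ) (s : Finset ι) :
    ∫ ω, (∑ i ∈ s, g i * a i ω) ^ 2 ∂μ ≤ ∑ i ∈ s, g i ^ 2 := by
  have hL : ∀ i, MemLp (fun ω => g i * a i ω) 2 μ := fun i => (h2 i).const_mul (g i)
  have hvar := IndepFun.variance_sum (μ := μ) (X := fun i ω => g i * a i ω) (s := s)
    (fun i _ => hL i)
    (fun i _ j _ hij => (ha.indepFun hij).comp (measurable_const_mul (g i))
      (measurable_const_mul (g j)))
  have hsum : (∑ i ∈ s, fun ω => g i * a i ω) = fun ω => ∑ i ∈ s, g i * a i ω := by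
    ext ω; simp
  rw [hsum, variance_of_integral_eq_zero
    (memLp_finsetSum s fun i _ => hL i).aestronglyMeasurable.aemeasurable] at hvar
  · rw [hvar]
    refine Finset.sum_le_sum fun i _ => ?_
    rw [variance_const_mul, variance_of_integral_eq_zero (hm i).aemeasurable (h0 i)]
    exact mul_le_of_le_one_right (sq_nonneg _) (hle i)
  · rw [integral_finsetSum s fun i _ => (hL i).integrable one_le_two]
    simp [integral_const_mul, h0]

/-- Adding coordinates one at a time produces a martingale. Each increment Z is orthogonal to the
past W, so second moments add up. -/
theorem memLp_centeredSqNorm_and_integral_sq_le [Fintype ι] [DecidableEq ι] {a : ι → Ω → ℝ}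
    (ha : iIndepFun a μ)
    (hm : ∀ i, Measurable (a i)) (h0 : ∀ i, ∫ ω, a i ω ∂μ = 0)
    (h4 : ∀ i, Integrable (fun ω => a i ω ^ 4) μ) (hle : ∀ i, ∫ ω, a i ω ^ 4 ∂μ ≤ 1)
    (b : ι → H) (s : Finset ι) :
    MemLp (fun ω => centeredSqNorm b (fun i => ∫ ω', a i ω' ^ 2 ∂μ) s (fun i => a i ω)) 2 μ ∧
      ∫ ω, centeredSqNorm b (fun i => ∫ ω', a i ω' ^ 2 ∂μ) s (fun i => a i ω) ^ 2 ∂μ ≤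
        8 * ∑ t ∈ s, ∑ i ∈ s, ⟪b t, b i⟫_ℝ ^ 2 := by
  set v : ι → ℝ := fun i => ∫ ω', a i ω' ^ 2 ∂μ with hv
  have hL2 : ∀ i, MemLp (a i) 2 μ := fun i => memLp_two_of_integrable_pow_four (hm i) (h4 i)
  have hle2 : ∀ i, ∫ ω, a i ω ^ 2 ∂μ ≤ 1 := fun i =>
    integral_sq_le_one_of_integral_pow_four_le_one (hm i) (h4 i) (hle i)
  induction s using Finset.induction_on with
  | empty => simp [centeredSqNorm]
  | insert t s ht ih =>
    obtain ⟨ihL, ih⟩ := ih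
    set W : Ω → ℝ := fun ω => centeredSqNorm b v s (fun i => a i ω) with hW
    set c : Ω → ℝ := fun ω => ∑ i ∈ s, ⟪b t, b i⟫_ℝ * a i ω with hc
    set d : ℝ := ‖b t‖ ^ 2 with hd
    have hcm : Measurable c := Finset.measurable_sum _ fun i _ => (hm i).const_mul _
    have hcL : MemLp c 2 μ := memLp_finsetSum s fun i _ => (hL2 i).const_mul _
    have hacL : MemLp (fun ω => a t ω * c ω) 2 μ := by
      have h := memLp_finsetSum (μ := μ) (p := 2) s
        (f := fun i ω => ⟪b t, b i⟫_ℝ * (a t ω * a i ω)) fun i _ =>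
          (memLp_two_mul_of_integrable_pow_four (hm t) (hm i) (h4 t) (h4 i)).const_mul _
      refine h.congr_norm ((hm t).mul hcm).aestronglyMeasurable
        (Filter.Eventually.of_forall fun ω => ?_)
      simp only [hc, Finset.mul_sum]
      congr 1
      exact Finset.sum_congr rfl fun i _ => by ring
    have hqL : MemLp (fun ω => a t ω ^ 2 - v t) 2 μ := by
      have h := memLp_two_mul_of_integrable_pow_four (hm t) (hm t) (h4 t) (h4 t)
      simp only [← sq] at h
      exact h.sub (memLp_const _)
    set Z : Ω → ℝ := fun ω => 2 * (a t ω * c ω) + d * (a t ω ^ 2 - v t) with hZ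
    have hZL : MemLp Z 2 μ := (hacL.const_mul 2).add (hqL.const_mul d)
    -- the summands indexed by `s` are independent of `a t`
    have hind : IndepFun (a t) (fun ω i => if i = t then 0 else a i ω) μ := by
      have hpt : Measurable fun x : ι → ℝ => x t := measurable_pi_apply t
      have h := (ha.indepFun_ite hm (fun i => i = t)).comp hpt measurable_id
      rwa [show (fun x : ι → ℝ => x t) ∘ (fun ω i => if i = t then a i ω else 0) = a t from
        funext fun ω => if_pos rfl] at h
    have hres : ∀ i ∈ s, i ≠ t := fun i hi h => ht (h ▸ hi)
    have hW' : ∀ ω, W ω = centeredSqNorm b v s (fun i => if i = t then 0 else a i ω) := fun ω => by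
      simp only [hW, centeredSqNorm]
      congr 3
      exact Finset.sum_congr rfl fun i hi => by rw [if_neg (hres i hi)]
    have hc' : ∀ ω, c ω = ∑ i ∈ s, ⟪b t, b i⟫_ℝ * (if i = t then 0 else a i ω) := fun ω =>
      Finset.sum_congr rfl fun i hi => by rw [if_neg (hres i hi)]
    have hcx : Measurable fun x : ι → ℝ => ∑ i ∈ s, ⟪b t, b i⟫_ℝ * x i := by fun_prop
    have hi1 : IndepFun (a t) (fun ω => W ω * c ω) μ := by
      have e : (fun ω => W ω * c ω) = (fun x => centeredSqNorm b v s x *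
          ∑ i ∈ s, ⟪b t, b i⟫_ℝ * x i) ∘ fun ω i => if i = t then 0 else a i ω :=
        funext fun ω => by rw [hW', hc']; rfl
      rw [e]
      exact hind.comp measurable_id ((measurable_centeredSqNorm b v s).mul hcx)
    have hi2 : IndepFun (fun ω => a t ω ^ 2 - v t) W μ := by
      rw [show W = centeredSqNorm b v s ∘ _ from funext hW']
      exact hind.comp (φ := fun x => x ^ 2 - v t) (by fun_prop)
        (measurable_centeredSqNorm b v s)
    have hi3 : IndepFun (fun ω => a t ω ^ 2) (fun ω => c ω ^ 2) μ := by
      have e : (fun ω => c ω ^ 2) = (fun x => (∑ i ∈ s, ⟪b t, b i⟫_ℝ * x i) ^ 2) ∘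
          fun ω i => if i = t then 0 else a i ω := funext fun ω => by rw [hc']; rfl
      rw [e]
      exact hind.comp (φ := fun x => x ^ 2) (by fun_prop) (hcx.pow_const 2)
    have hWm : AEStronglyMeasurable W μ := ihL.aestronglyMeasurable
    have hcs : AEStronglyMeasurable c μ := hcL.aestronglyMeasurable
    have hWZ : ∫ ω, W ω * Z ω ∂μ = 0 := by
      have e1 : ∀ ω, W ω * Z ω = 2 * (W ω * (a t ω * c ω)) + d * ((a t ω ^ 2 - v t) * W ω) :=
        fun ω => by simp only [hZ]; ring
      have e2 : ∫ ω, W ω * (a t ω * c ω) ∂μ = 0 := by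
        have : ∀ ω, W ω * (a t ω * c ω) = a t ω * (W ω * c ω) := fun ω => by ring
        simp only [this]
        rw [hi1.integral_fun_mul_eq_mul_integral (hm t).aestronglyMeasurable (hWm.mul hcs), h0,
          zero_mul]
      have e3 : ∫ ω, (a t ω ^ 2 - v t) * W ω ∂μ = 0 := by
        rw [hi2.integral_fun_mul_eq_mul_integral hqL.aestronglyMeasurable hWm,
          integral_sub (hL2 t).integrable_sq (integrable_const _)]
        simp [hv]
      have i1 : Integrable (fun ω => W ω * (a t ω * c ω)) μ := ihL.integrable_mul hacL
      have i2 : Integrable (fun ω => (a t ω ^ 2 - v t) * W ω) μ := hqL.integrable_mul ihL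
      simp only [e1]
      rw [integral_add (i1.const_mul _) (i2.const_mul _), integral_const_mul, integral_const_mul,
        e2, e3]
      simp
    have hac2 : ∫ ω, (a t ω * c ω) ^ 2 ∂μ ≤ ∑ i ∈ s, ⟪b t, b i⟫_ℝ ^ 2 := by
      have hc2 := integral_sq_sum_mul_le ha hm h0 hL2 hle2 (fun i => ⟪b t, b i⟫_ℝ) s
      simp only [mul_pow]
      rw [hi3.integral_fun_mul_eq_mul_integral ((hm t).pow_const 2).aestronglyMeasurable
        (hcm.pow_const 2).aestronglyMeasurable]
      exact (mul_le_of_le_one_left (integral_nonneg fun _ => sq_nonneg _) (hle2 t)).trans hc2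
    have hq2 : ∫ ω, (a t ω ^ 2 - v t) ^ 2 ∂μ ≤ 1 := by
      rw [hv, integral_sq_sub_integral_sq_sq_eq (hm t) (h4 t)]
      linarith [hle t, sq_nonneg (∫ ω, a t ω ^ 2 ∂μ)]
    have hZ2 : ∫ ω, Z ω ^ 2 ∂μ ≤ 8 * ∑ i ∈ s, ⟪b t, b i⟫_ℝ ^ 2 + 2 * d ^ 2 := by
      have i1 := hacL.integrable_sq.const_mul 8
      have i2 := hqL.integrable_sq.const_mul (2 * d ^ 2)
      calc ∫ ω, Z ω ^ 2 ∂μ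
          ≤ ∫ ω, (8 * (a t ω * c ω) ^ 2 + 2 * d ^ 2 * (a t ω ^ 2 - v t) ^ 2) ∂μ :=
            integral_mono hZL.integrable_sq (i1.add i2) fun ω => by
              simp only [hZ]
              nlinarith [sq_nonneg (2 * (a t ω * c ω) - d * (a t ω ^ 2 - v t))]
        _ = 8 * ∫ ω, (a t ω * c ω) ^ 2 ∂μ + 2 * d ^ 2 * ∫ ω, (a t ω ^ 2 - v t) ^ 2 ∂μ := by
            rw [integral_add i1 i2, integral_const_mul, integral_const_mul]
        _ ≤ _ := add_le_add (mul_le_mul_of_nonneg_left hac2 (by norm_num))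
            (mul_le_of_le_one_right (by positivity) hq2)
    have hins : ∀ ω, centeredSqNorm b v (insert t s) (fun i => a i ω) = W ω + Z ω := fun ω =>
      centeredSqNorm_insert b v ht _
    simp only [hins]
    refine ⟨ihL.add hZL, ?_⟩
    have i3 : Integrable (fun ω => 2 * (W ω * Z ω)) μ := (ihL.integrable_mul hZL).const_mul 2
    have i4 : Integrable (fun ω => W ω ^ 2 + 2 * (W ω * Z ω)) μ := ihL.integrable_sq.add i3
    have hexp : ∫ ω, (W ω + Z ω) ^ 2 ∂μ = ∫ ω, W ω ^ 2 ∂μ + ∫ ω, Z ω ^ 2 ∂μ := by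
      have : ∀ ω, (W ω + Z ω) ^ 2 = W ω ^ 2 + 2 * (W ω * Z ω) + Z ω ^ 2 := fun ω => by ring
      simp only [this]
      rw [integral_add i4 hZL.integrable_sq, integral_add ihL.integrable_sq i3,
        integral_const_mul, hWZ]
      ring
    have hdd : ⟪b t, b t⟫_ℝ = d := real_inner_self_eq_norm_sq _
    have hS : ∑ j ∈ insert t s, ∑ i ∈ insert t s, ⟪b j, b i⟫_ℝ ^ 2 =
        d ^ 2 + ∑ i ∈ s, ⟪b t, b i⟫_ℝ ^ 2 + (∑ j ∈ s, ⟪b j, b t⟫_ℝ ^ 2 +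
          ∑ j ∈ s, ∑ i ∈ s, ⟪b j, b i⟫_ℝ ^ 2) := by
      rw [Finset.sum_insert ht, Finset.sum_insert ht, hdd, ← Finset.sum_add_distrib]
      congr 1
      exact Finset.sum_congr rfl fun j _ => Finset.sum_insert ht
    have hS0 : 0 ≤ ∑ j ∈ s, ⟪b j, b t⟫_ℝ ^ 2 := Finset.sum_nonneg fun _ _ => sq_nonneg _
    rw [hexp, hS]
    -- The increment needs 8 times one off-diagonal row and 2 times the diagonal term, while the
    -- double sum supplies 8 times the row, the column and the diagonal.
    nlinarith [sq_nonneg d]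

end CenteredSquareNorm

/-! ### Integration and measurability of matrices by entries. -/

section MatrixIntegral

open Matrix

variable {Ω m l : Type*} [MeasurableSpace Ω] {μ : Measure Ω} [Fintype m] [Fintype l]
  [DecidableEq l]

theorem integral_matrix_apply {f : Ω → Matrix m l ℝ} (hf : Integrable f μ) (i : m) (j : l) :
    (∫ ω, f ω ∂μ) i j = ∫ ω, f ω i j ∂μ :=
  ((LinearMap.toContinuousLinearMap (entryLinearMap ℝ ℝ i j)).integral_comp_comm hf).symm

theorem integral_mul_mul {k r : Type*} [Fintype k] [Fintype r] [DecidableEq k] [DecidableEq r]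
    {f : Ω → Matrix m l ℝ} (hf : Integrable f μ) (B : Matrix k m ℝ) (D : Matrix l r ℝ) :
    ∫ ω, B * f ω * D ∂μ = B * (∫ ω, f ω ∂μ) * D := by
  let T : Matrix m l ℝ →ₗ[ℝ] Matrix k r ℝ :=
    { toFun := fun X => B * X * D
      map_add' := fun X Y => by rw [Matrix.mul_add, Matrix.add_mul]
      map_smul' := fun c X => by simp }
  exact (LinearMap.toContinuousLinearMap T).integral_comp_comm hf

variable [DecidableEq m]

theorem stronglyMeasurable_of_entry {f : Ω → Matrix m l ℝ}
    (h : ∀ i j, Measurable fun ω => f ω i j) : StronglyMeasurable f := by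
  have e : f = fun ω => ∑ i, ∑ j, f ω i j • single i j (1 : ℝ) := by
    ext1 ω
    conv_lhs => rw [matrix_eq_sum_single (f ω)]
    simp [smul_single]
  rw [e]
  exact Finset.stronglyMeasurable_fun_sum _ fun i _ => Finset.stronglyMeasurable_fun_sum _
    fun j _ => (h i j).stronglyMeasurable.smul_const _

theorem integrable_of_entry {f : Ω → Matrix m l ℝ}
    (h : ∀ i j, Integrable (fun ω => f ω i j) μ) : Integrable f μ := by
  have e : f = fun ω => ∑ i, ∑ j, f ω i j • single i j (1 : ℝ) := by
    ext1 ω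
    conv_lhs => rw [matrix_eq_sum_single (f ω)]
    simp [smul_single]
  rw [e]
  exact integrable_finsetSum _ fun i _ => integrable_finsetSum _ fun j _ => (h i j).smul_const _

end MatrixIntegral

/-! ### Gram matrix estimates for the fixed factor. -/

section DeterministicMatrix

open Matrix
open scoped InnerProductSpace

variable {m κ : Type*} [Fintype m] [Fintype κ] (B : Matrix m κ ℝ)

/-- The columns of a matrix as Euclidean vectors. -/
def euclideanCol (i : κ) : EuclideanSpace ℝ m := WithLp.toLp 2 (B.col i)

theorem mulVec_dotProduct_self_eq (x : κ → ℝ) :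
    (B *ᵥ x) ⬝ᵥ (B *ᵥ x) = ‖∑ i, x i • euclideanCol B i‖ ^ 2 := by
  rw [EuclideanSpace.norm_sq_eq]
  refine Finset.sum_congr rfl fun k _ => ?_
  have : (∑ i, x i • euclideanCol B i) k = (B *ᵥ x) k := by
    simp [euclideanCol, mulVec, dotProduct, mul_comm]
  rw [this, Real.norm_eq_abs, sq_abs, sq]

variable [DecidableEq m] [DecidableEq κ]

theorem sum_norm_euclideanCol_sq_le (hB : ‖B‖ ≤ 1) :
    ∑ i, ‖euclideanCol B i‖ ^ 2 ≤ Fintype.card m := by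
  have hB2 : ‖B‖ ^ 2 ≤ 1 := pow_le_one₀ (norm_nonneg _) hB
  have h : ∀ k : m, ∑ i, B k i ^ 2 ≤ 1 := fun k => by
    have := dotProduct_self_vecMul_le B (Pi.single k 1)
    rw [single_one_vecMul, single_one_dotProduct, Pi.single_eq_same, mul_one] at this
    refine le_trans (le_of_eq ?_) (this.trans hB2)
    exact Finset.sum_congr rfl fun i _ => sq _
  simp only [EuclideanSpace.norm_sq_eq, Real.norm_eq_abs, sq_abs]
  rw [Finset.sum_comm]
  refine (Finset.sum_le_sum fun k _ => h k).trans (by simp)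

/-- This is the squared Frobenius norm of BᵀB. Applying Bᵀ to the columns of B does not increase
their length, so it is at most that of B. -/
theorem sum_sum_inner_euclideanCol_sq_le (hB : ‖B‖ ≤ 1) :
    ∑ t, ∑ i, ⟪euclideanCol B t, euclideanCol B i⟫_ℝ ^ 2 ≤ Fintype.card m := by
  have hB2 : ‖B‖ ^ 2 ≤ 1 := pow_le_one₀ (norm_nonneg _) hB
  refine (Finset.sum_le_sum fun t _ => ?_).trans (sum_norm_euclideanCol_sq_le B hB)
  have h := dotProduct_self_vecMul_le B (B.col t)
  have e1 : (B.col t ᵥ* B) ⬝ᵥ (B.col t ᵥ* B) =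
      ∑ i, ⟪euclideanCol B t, euclideanCol B i⟫_ℝ ^ 2 := by
    refine Finset.sum_congr rfl fun i _ => ?_
    rw [EuclideanSpace.inner_eq_star_dotProduct, dotProduct_comm, sq]
    rfl
  have e2 : B.col t ⬝ᵥ B.col t = ‖euclideanCol B t‖ ^ 2 := by
    rw [EuclideanSpace.norm_sq_eq]
    exact Finset.sum_congr rfl fun i _ => by rw [Real.norm_eq_abs, sq_abs, sq]; rfl
  rw [e1, e2] at h
  exact h.trans (mul_le_of_le_one_left (sq_nonneg _) hB2)

end DeterministicMatrix

/-! ### Second moment of the norm of the product. -/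

section ProductBound

open Matrix

variable {Ω κ m ι : Type*} [MeasurableSpace Ω] {μ : Measure Ω} [Fintype κ] [Fintype ι]
  {A : Ω → Matrix κ ι ℝ} (B : Matrix m κ ℝ)

/-- The rank-one matrix `y yᵀ` with `y = B x`. -/
def outerMulVec (B : Matrix m κ ℝ) (x : κ → ℝ) : Matrix m m ℝ := vecMulVec (B *ᵥ x) (B *ᵥ x)

theorem measurable_outerMulVec_apply {x : Ω → κ → ℝ} (hx : ∀ i, Measurable fun ω => x ω i)
    (k l : m) : Measurable fun ω => outerMulVec B (x ω) k l := by
  have h : ∀ k, Measurable fun ω => (B *ᵥ x ω) k := fun k =>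
    Finset.measurable_sum _ fun i _ => (hx i).const_mul _
  exact (h k).mul (h l)

theorem integrable_outerMulVec [Fintype m] [DecidableEq m]
    {x : Ω → κ → ℝ} (hx : ∀ i, MemLp (fun ω => x ω i) 2 μ) :
    Integrable (fun ω => outerMulVec B (x ω)) μ := by
  have h : ∀ k, MemLp (fun ω => (B *ᵥ x ω) k) 2 μ := fun k =>
    memLp_finsetSum _ fun i _ => (hx i).const_mul _
  exact integrable_of_entry fun k l => (h k).integrable_mul (h l)

/-- For each fixed s, the columns with sign + and those with sign − are independent blocks: their
sum is S and their difference is the signed sum. -/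
theorem integral_norm_sum_outerMulVec_sub_le [IsProbabilityMeasure μ] [Fintype m] [DecidableEq m] [DecidableEq κ]
    (hm : ∀ i j, Measurable fun ω => A ω i j)
    (hA : iIndepFun (fun (p : κ × ι) (ω : Ω) => A ω p.1 p.2) μ)
    (h2 : ∀ i j, MemLp (fun ω => A ω i j) 2 μ) (s : ι → ℤˣ) :
    ∫ ω, ‖∑ j, outerMulVec B ((A ω).col j) - ∫ ω', ∑ j, outerMulVec B ((A ω').col j) ∂μ‖ ∂μ ≤
      4 * ∫ ω, ‖signedSum (fun j => outerMulVec B ((A ω).col j)) s‖ ∂μ := by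
  let F : (κ × ι → ℝ) → Matrix m m ℝ := fun x =>
    ∑ j ∈ Finset.univ.filter (fun j => s j = 1), outerMulVec B fun i => x (i, j)
  let G : (κ × ι → ℝ) → Matrix m m ℝ := fun x =>
    ∑ j ∈ Finset.univ.filter (fun j => ¬ s j = 1), outerMulVec B fun i => x (i, j)
  let U : Ω → κ × ι → ℝ := fun ω p => if s p.2 = 1 then A ω p.1 p.2 else 0
  let V : Ω → κ × ι → ℝ := fun ω p => if s p.2 = 1 then 0 else A ω p.1 p.2
  have hsm : ∀ j, StronglyMeasurable fun x : κ × ι → ℝ => outerMulVec B fun i => x (i, j) :=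
    fun j => stronglyMeasurable_of_entry
      (measurable_outerMulVec_apply B fun i => measurable_pi_apply (i, j))
  have hF : StronglyMeasurable F := Finset.stronglyMeasurable_fun_sum _ fun j _ => hsm j
  have hG : StronglyMeasurable G := Finset.stronglyMeasurable_fun_sum _ fun j _ => hsm j
  have hU : Measurable U := measurable_pi_lambda _ fun p => by
    by_cases h : s p.2 = 1
    · simpa only [U, h, if_true] using hm p.1 p.2
    · simpa only [U, h, if_false] using measurable_const
  have hV : Measurable V := measurable_pi_lambda _ fun p => by
    by_cases h : s p.2 = 1
    · simpa only [V, h, if_true] using measurable_const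
    · simpa only [V, h, if_false] using hm p.1 p.2
  have hUV : IndepFun U V μ := hA.indepFun_ite (fun p => hm p.1 p.2) fun p => s p.2 = 1
  have hFU : ∀ ω, F (U ω) = ∑ j ∈ Finset.univ.filter (fun j => s j = 1),
      outerMulVec B ((A ω).col j) := fun ω => Finset.sum_congr rfl fun j hj => by
    have h : s j = 1 := (Finset.mem_filter.1 hj).2
    simp only [U, h, if_true]
    rfl
  have hGV : ∀ ω, G (V ω) = ∑ j ∈ Finset.univ.filter (fun j => ¬ s j = 1),
      outerMulVec B ((A ω).col j) := fun ω => Finset.sum_congr rfl fun j hj => by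
    have h : ¬ s j = 1 := (Finset.mem_filter.1 hj).2
    simp only [V, h, if_false]
    rfl
  have hint : ∀ j, Integrable (fun ω => outerMulVec B ((A ω).col j)) μ := fun j =>
    integrable_outerMulVec B fun i => h2 i j
  have hadd : ∀ ω, F (U ω) + G (V ω) = ∑ j, outerMulVec B ((A ω).col j) := fun ω => by
    rw [hFU, hGV, Finset.sum_filter_add_sum_filter_not]
  have hsub : ∀ ω, F (U ω) - G (V ω) = signedSum (fun j => outerMulVec B ((A ω).col j)) s :=
      fun ω => by
    rw [hFU, hGV, signedSum, ← Finset.sum_filter_add_sum_filter_not Finset.univ (fun j => s j = 1),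
      sub_eq_add_neg, ← Finset.sum_neg_distrib]
    congr 1
    · exact Finset.sum_congr rfl fun j hj => by simp [(Finset.mem_filter.1 hj).2]
    · exact Finset.sum_congr rfl fun j hj => by
        simp [(Int.units_eq_one_or (s j)).resolve_left (Finset.mem_filter.1 hj).2]
  have h := hUV.integral_norm_add_sub_integral_le hU hV hF hG
    (by simp only [hFU]; exact integrable_finsetSum _ fun j _ => hint j)
    (by simp only [hGV]; exact integrable_finsetSum _ fun j _ => hint j)
  simpa only [hadd, hsub] using h

theorem sum_outerMulVec_eq (X : Matrix κ ι ℝ) :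
    ∑ j, outerMulVec B (X.col j) = B * (X * Xᵀ) * Bᵀ := by
  have h := sum_vecMulVec_col_eq (B * X)
  rw [transpose_mul] at h
  rw [← Matrix.mul_assoc B, Matrix.mul_assoc (B * X), ← h]
  rfl

/-- Independence and zero means make E AAᵀ diagonal, and each diagonal entry is a sum of second
moments, each at most 1, over the columns. -/
theorem norm_integral_sum_outerMulVec_le [Fintype m] [DecidableEq m] [DecidableEq κ] [DecidableEq ι]
    (hA : iIndepFun (fun (p : κ × ι) (ω : Ω) => A ω p.1 p.2) μ)
    (h0 : ∀ i j, ∫ ω, A ω i j ∂μ = 0)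
    (h2 : ∀ i j, MemLp (fun ω => A ω i j) 2 μ) (hle : ∀ i j, ∫ ω, A ω i j ^ 2 ∂μ ≤ 1)
    (hB : ‖B‖ ≤ 1) :
    ‖∫ ω, ∑ j, outerMulVec B ((A ω).col j) ∂μ‖ ≤ Fintype.card ι := by
  have hij : ∀ i i' j, Integrable (fun ω => A ω i j * A ω i' j) μ := fun i i' j =>
    (h2 i j).integrable_mul (h2 i' j)
  have hint : Integrable (fun ω => A ω * (A ω)ᵀ) μ := integrable_of_entry fun i i' => by
    simp only [mul_apply, transpose_apply]
    exact integrable_finsetSum _ fun j _ => hij i i' j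
  have hdiag : ∫ ω, A ω * (A ω)ᵀ ∂μ = diagonal fun i => ∑ j, ∫ ω, A ω i j ^ 2 ∂μ := by
    ext i i'
    rw [integral_matrix_apply hint]
    simp only [mul_apply, transpose_apply]
    rw [integral_finsetSum _ fun j _ => hij i i' j]
    by_cases h : i = i'
    · subst h
      simp only [diagonal_apply_eq, sq]
    · rw [diagonal_apply_ne _ h]
      refine Finset.sum_eq_zero fun j _ => ?_
      have hind : IndepFun (fun ω => A ω i j) (fun ω => A ω i' j) μ :=
        hA.indepFun (i := (i, j)) (j := (i', j)) (by simp [h])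
      rw [hind.integral_fun_mul_eq_mul_integral (h2 i j).aestronglyMeasurable
        (h2 i' j).aestronglyMeasurable, h0, zero_mul]
  have hd : ‖(diagonal fun i => ∑ j, ∫ ω, A ω i j ^ 2 ∂μ : Matrix κ κ ℝ)‖ ≤ Fintype.card ι := by
    rw [l2_opNorm_diagonal]
    refine (pi_norm_le_iff_of_nonneg (by positivity)).2 fun i => ?_
    rw [Real.norm_of_nonneg (Finset.sum_nonneg fun j _ => integral_nonneg fun _ => sq_nonneg _)]
    exact (Finset.sum_le_sum fun j _ => hle i j).trans (by simp)
  have hBt : ‖Bᵀ‖ ≤ 1 := by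
    rwa [← conjTranspose_eq_transpose_of_trivial, l2_opNorm_conjTranspose]
  simp only [sum_outerMulVec_eq]
  rw [integral_mul_mul hint, hdiag]
  calc _ ≤ ‖B * diagonal fun i => ∑ j, ∫ ω, A ω i j ^ 2 ∂μ‖ * ‖Bᵀ‖ := l2_opNorm_mul _ _
    _ ≤ ‖B * diagonal fun i => ∑ j, ∫ ω, A ω i j ^ 2 ∂μ‖ :=
        mul_le_of_le_one_right (norm_nonneg _) hBt
    _ ≤ ‖B‖ * ‖(diagonal fun i => ∑ j, ∫ ω, A ω i j ^ 2 ∂μ : Matrix κ κ ℝ)‖ := l2_opNorm_mul _ _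
    _ ≤ ‖(diagonal fun i => ∑ j, ∫ ω, A ω i j ^ 2 ∂μ : Matrix κ κ ℝ)‖ :=
        mul_le_of_le_one_left (norm_nonneg _) hB
    _ ≤ _ := hd

/-- The columns of `B * A` are dominated by a random variable whose mean is of the order of the
dimension. -/
theorem exists_bound_dotProduct_col [IsProbabilityMeasure μ] [Fintype m] [DecidableEq m]
    [DecidableEq κ] [Nonempty m] (hcard : Fintype.card ι = Fintype.card m)
    (hm : ∀ i j, Measurable fun ω => A ω i j)
    (hA : iIndepFun (fun (p : κ × ι) (ω : Ω) => A ω p.1 p.2) μ)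
    (h0 : ∀ i j, ∫ ω, A ω i j ∂μ = 0)
    (h4 : ∀ i j, Integrable (fun ω => A ω i j ^ 4) μ) (hle : ∀ i j, ∫ ω, A ω i j ^ 4 ∂μ ≤ 1)
    (hB : ‖B‖ ≤ 1) :
    ∃ R : Ω → ℝ, (∀ ω, 0 ≤ R ω) ∧ (∀ ω j, (B * A ω).col j ⬝ᵥ (B * A ω).col j ≤ R ω) ∧
      Integrable R μ ∧ ∫ ω, R ω ∂μ ≤ 10 * Fintype.card m := by
  set n : ℝ := ((Fintype.card m : ℕ) : ℝ) with hn
  have hn0 : 0 < n := by rw [hn]; exact_mod_cast Fintype.card_pos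
  have hle2 : ∀ i j, ∫ ω, A ω i j ^ 2 ∂μ ≤ 1 := fun i j =>
    integral_sq_le_one_of_integral_pow_four_le_one (hm i j) (h4 i j) (hle i j)
  let W : ι → Ω → ℝ := fun j ω => centeredSqNorm (euclideanCol B)
    (fun i => ∫ ω', A ω' i j ^ 2 ∂μ) Finset.univ (fun i => A ω i j)
  have hW : ∀ j, MemLp (W j) 2 μ ∧ ∫ ω, W j ω ^ 2 ∂μ ≤ 8 * n := fun j => by
    have hAj : iIndepFun (fun i ω => A ω i j) μ :=
      hA.precomp (g := fun i => (i, j)) fun i i' h => (Prod.mk.inj h).1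
    have h := memLp_centeredSqNorm_and_integral_sq_le hAj (fun i => hm i j) (fun i => h0 i j)
      (fun i => h4 i j) (fun i => hle i j) (euclideanCol B) Finset.univ
    exact ⟨h.1, h.2.trans (mul_le_mul_of_nonneg_left (sum_sum_inner_euclideanCol_sq_le B hB)
      (by norm_num))⟩
  have hWi : Integrable (fun ω => ∑ j, W j ω ^ 2) μ :=
    integrable_finsetSum _ fun j _ => (hW j).1.integrable_sq
  have hWs : ∀ ω, 0 ≤ ∑ j, W j ω ^ 2 := fun ω => Finset.sum_nonneg fun _ _ => sq_nonneg _
  -- One n bounds the mean of |y_j|². The rest comes from W ≤ n + W²/n, which replaces the maximum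
  -- over j by a sum with mean at most 8n.
  refine ⟨fun ω => 2 * n + (∑ j, W j ω ^ 2) / n, fun ω => ?_, fun ω j => ?_,
    (integrable_const _).add (hWi.div_const n), ?_⟩
  · exact add_nonneg (by positivity) (div_nonneg (hWs ω) hn0.le)
  · have e : (B * A ω).col j ⬝ᵥ (B * A ω).col j =
        W j ω + ∑ i, (∫ ω', A ω' i j ^ 2 ∂μ) * ‖euclideanCol B i‖ ^ 2 := by
      have := mulVec_dotProduct_self_eq B ((A ω).col j)
      simp only [W, centeredSqNorm, sub_add_cancel]
      exact this
    have h1 : ∑ i, (∫ ω', A ω' i j ^ 2 ∂μ) * ‖euclideanCol B i‖ ^ 2 ≤ n :=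
      (Finset.sum_le_sum fun i _ => mul_le_of_le_one_left (sq_nonneg _) (hle2 i j)).trans
        (sum_norm_euclideanCol_sq_le B hB)
    have h2 : W j ω ^ 2 ≤ ∑ j, W j ω ^ 2 :=
      Finset.single_le_sum (f := fun j => W j ω ^ 2) (fun _ _ => sq_nonneg _) (Finset.mem_univ j)
    have h3 : W j ω ≤ n + (∑ j, W j ω ^ 2) / n := by
      rw [← sub_le_iff_le_add', le_div_iff₀ hn0]
      nlinarith [sq_nonneg (W j ω - n)]
    rw [e]
    linarith
  · rw [integral_add (integrable_const _) (hWi.div_const n), integral_div,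
      integral_finsetSum _ fun j _ => (hW j).1.integrable_sq]
    have h1 : ∑ j, ∫ ω, W j ω ^ 2 ∂μ ≤ 8 * n * n :=
      (Finset.sum_le_sum fun j _ => (hW j).2).trans (by
        rw [Finset.sum_const, Finset.card_univ, hcard, nsmul_eq_mul, ← hn]; linarith)
    have h2 : (∑ j, ∫ ω, W j ω ^ 2 ∂μ) / n ≤ 8 * n := by rwa [div_le_iff₀ hn0]
    simp only [integral_const, probReal_univ, one_smul]
    linarith

theorem integrable_norm_sq_and_integral_norm_sq_mul_le [IsProbabilityMeasure μ]
    [Fintype m] [DecidableEq m] [DecidableEq κ] [DecidableEq ι] [Nonempty m]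
    (hcard : Fintype.card ι = Fintype.card m)
    (hm : ∀ i j, Measurable fun ω => A ω i j)
    (hA : iIndepFun (fun (p : κ × ι) (ω : Ω) => A ω p.1 p.2) μ)
    (h0 : ∀ i j, ∫ ω, A ω i j ∂μ = 0)
    (h4 : ∀ i j, Integrable (fun ω => A ω i j ^ 4) μ) (hle : ∀ i j, ∫ ω, A ω i j ^ 4 ∂μ ≤ 1)
    (hB : ‖B‖ ≤ 1) (p : ℕ) (hp : 0 < p) (hcp : (Fintype.card m : ℝ) ≤ Real.exp p) :
    Integrable (fun ω => ‖B * A ω‖ ^ 2) μ ∧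
      ∫ ω, ‖B * A ω‖ ^ 2 ∂μ ≤ 2 * Fintype.card m + 960 * p * Fintype.card m := by
  have h2 : ∀ i j, MemLp (fun ω => A ω i j) 2 μ := fun i j =>
    memLp_two_of_integrable_pow_four (hm i j) (h4 i j)
  have hle2 : ∀ i j, ∫ ω, A ω i j ^ 2 ∂μ ≤ 1 := fun i j =>
    integral_sq_le_one_of_integral_pow_four_le_one (hm i j) (h4 i j) (hle i j)
  obtain ⟨R, hR0, hR, hRi, hRn⟩ := exists_bound_dotProduct_col B hcard hm hA h0 h4 hle hB
  set K : ℝ := ((Fintype.card (ι → ℤˣ) : ℕ) : ℝ) with hK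
  have hK0 : 0 < K := by rw [hK]; exact_mod_cast Fintype.card_pos
  set S : Ω → Matrix m m ℝ := fun ω => ∑ j, outerMulVec B ((A ω).col j) with hS
  set Y : (ι → ℤˣ) → Ω → ℝ := fun s ω => ‖signedSum (fun j => outerMulVec B ((A ω).col j)) s‖
    with hY
  have hint : ∀ j, Integrable (fun ω => outerMulVec B ((A ω).col j)) μ := fun j =>
    integrable_outerMulVec B fun i => h2 i j
  have hSi : Integrable S μ := integrable_finsetSum _ fun j _ => hint j
  have hYi : ∀ s, Integrable (Y s) μ := fun s =>
    (integrable_finsetSum _ fun j _ => (hint j).smul ((s j : ℤ) : ℝ)).norm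
  have hSM : ∀ ω, ‖S ω‖ = ‖B * A ω‖ ^ 2 := fun ω => norm_sum_vecMulVec_col (B * A ω)
  have hMi : Integrable (fun ω => ‖B * A ω‖ ^ 2) μ := by
    simpa only [hSM] using hSi.norm
  refine ⟨hMi, ?_⟩
  -- AM-GM with weights 1/8 and 12, as 4 · 12/8 = 6. The factor 4 from symmetrization then leaves
  -- half of E‖BA‖², which is absorbed because it is finite.
  have hrud : ∀ ω, (∑ s, Y s ω) / K ≤ ‖B * A ω‖ ^ 2 / 8 + 12 * p * R ω := fun ω => by
    have h := sum_norm_signedSum_vecMulVec_sq_le (B * A ω) (hR0 ω) (hR ω) p hp hcp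
    have hpR : 0 ≤ (p : ℝ) * R ω := mul_nonneg (by positivity) (hR0 ω)
    refine le_of_sq_le_sq (a := (∑ s, Y s ω) / K) (h.trans ?_) (by nlinarith [sq_nonneg ‖B * A ω‖])
    nlinarith [sq_nonneg (‖B * A ω‖ ^ 2 / 8 - 12 * p * R ω)]
  have hsym : ∫ ω, ‖S ω - ∫ ω', S ω' ∂μ‖ ∂μ ≤ 4 * ∫ ω, (∑ s, Y s ω) / K ∂μ := by
    have h := Finset.sum_le_sum fun (s : ι → ℤˣ) (_ : s ∈ Finset.univ) =>
      integral_norm_sum_outerMulVec_sub_le B hm hA h2 s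
    rw [Finset.sum_const, Finset.card_univ, nsmul_eq_mul, ← hK, ← Finset.mul_sum] at h
    rw [integral_div, integral_finsetSum _ fun s _ => hYi s, ← mul_div_assoc, le_div_iff₀ hK0,
      mul_comm]
    exact h
  have hbound : ∫ ω, (∑ s, Y s ω) / K ∂μ ≤
      (∫ ω, ‖B * A ω‖ ^ 2 ∂μ) / 8 + 12 * p * (10 * Fintype.card m) := by
    calc ∫ ω, (∑ s, Y s ω) / K ∂μ
        ≤ ∫ ω, (‖B * A ω‖ ^ 2 / 8 + 12 * p * R ω) ∂μ :=
          integral_mono ((integrable_finsetSum _ fun s _ => hYi s).div_const K)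
            ((hMi.div_const 8).add (hRi.const_mul _)) hrud
      _ = (∫ ω, ‖B * A ω‖ ^ 2 ∂μ) / 8 + 12 * p * ∫ ω, R ω ∂μ := by
          rw [integral_add (hMi.div_const 8) (hRi.const_mul _), integral_div, integral_const_mul]
      _ ≤ _ := by gcongr
  have hmean := norm_integral_sum_outerMulVec_le B hA h0 h2 hle2 hB
  rw [hcard] at hmean
  have htri : ∫ ω, ‖B * A ω‖ ^ 2 ∂μ ≤ ∫ ω, ‖S ω - ∫ ω', S ω' ∂μ‖ ∂μ + ‖∫ ω', S ω' ∂μ‖ := by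
    have hc : Integrable (fun ω => ‖S ω - ∫ ω', S ω' ∂μ‖) μ := (hSi.sub (integrable_const _)).norm
    calc ∫ ω, ‖B * A ω‖ ^ 2 ∂μ ≤ ∫ ω, (‖S ω - ∫ ω', S ω' ∂μ‖ + ‖∫ ω', S ω' ∂μ‖) ∂μ :=
          integral_mono hMi (hc.add (integrable_const _)) fun ω => by
            simp only [← hSM]
            simpa using norm_add_le (S ω - ∫ ω', S ω' ∂μ) (∫ ω', S ω' ∂μ)
      _ = _ := by
          rw [integral_add hc (integrable_const _)]
          simp
  linarith

end ProductBound

/-! ### Choice of the exponent and passage to the first moment. -/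

theorem mainTheorem5 :
    ∃ C : ℝ, 0 < C ∧
      ∀ (N n : ℕ), 0 < N → 0 < n →
      ∀ (Ω : Type*) [MeasurableSpace Ω] (μ : Measure Ω) [IsProbabilityMeasure μ]
        (A : Ω → Matrix (Fin N) (Fin n) ℝ) (B : Matrix (Fin n) (Fin N) ℝ),
        (∀ i j, Measurable (fun ω => A ω i j)) →
        iIndepFun (fun (p : Fin N × Fin n) (ω : Ω) => A ω p.1 p.2) μ →
        (∀ i j, ∫ ω, A ω i j ∂μ = 0) →
        (∀ i j, Integrable (fun ω => (A ω i j) ^ 4) μ ∧ ∫ ω, (A ω i j) ^ 4 ∂μ ≤ 1) →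
        ‖B‖ ≤ 1 →
        Integrable (fun ω => ‖B * A ω‖) μ ∧
          ∫ ω, ‖B * A ω‖ ∂μ ≤ C * Real.sqrt (n * Real.log (2 * n)) := by
  refine ⟨50, by norm_num, fun N n _ hn Ω _ μ _ A B hm hA h0 h4 hB => ?_⟩
  have : Nonempty (Fin n) := ⟨⟨0, hn⟩⟩
  have hn1 : (1 : ℝ) ≤ n := by exact_mod_cast hn
  set L := Real.log (2 * n) with hL
  have hL0 : 0.69 ≤ L := by
    have : Real.log 2 ≤ L := Real.log_le_log (by norm_num) (by linarith)
    linarith [Real.log_two_gt_d9]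
  have hLp : L ≤ ⌈L⌉₊ := Nat.le_ceil L
  have hp : 0 < ⌈L⌉₊ := Nat.ceil_pos.2 (by linarith)
  -- Rounding up costs at most 1 ≤ 1.5 L, because L ≥ log 2 > 0.69.
  have hpL : (⌈L⌉₊ : ℝ) ≤ 2.5 * L := by
    have := Nat.ceil_lt_add_one (show 0 ≤ L by linarith)
    linarith
  have hcp : (Fintype.card (Fin n) : ℝ) ≤ Real.exp ⌈L⌉₊ := by
    have h1 : Real.exp L = 2 * n := Real.exp_log (by linarith)
    have h2 := Real.exp_le_exp.2 hLp
    rw [Fintype.card_fin]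
    linarith
  obtain ⟨hi, hle⟩ := integrable_norm_sq_and_integral_norm_sq_mul_le B rfl hm hA h0
    (fun i j => (h4 i j).1) (fun i j => (h4 i j).2) hB ⌈L⌉₊ hp hcp
  rw [Fintype.card_fin] at hle
  have hentry : ∀ i j, Measurable fun ω => (B * A ω) i j := fun i j => by
    simp only [Matrix.mul_apply]
    exact Finset.measurable_sum _ fun k _ => (hm k j).const_mul _
  have hsm : AEStronglyMeasurable (fun ω => ‖B * A ω‖) μ :=
    (stronglyMeasurable_of_entry hentry).norm.aestronglyMeasurable
  have hint : Integrable (fun ω => ‖B * A ω‖) μ :=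
    ((memLp_two_iff_integrable_sq hsm).2 hi).integrable one_le_two
  refine ⟨hint, ?_⟩
  have hnL : 0 < n * L := by nlinarith
  set t := 50 * Real.sqrt (n * L) with ht
  have ht0 : 0 < t := by positivity
  have ht2 : t ^ 2 = 2500 * (n * L) := by
    rw [ht, mul_pow, Real.sq_sqrt hnL.le]
    norm_num
  -- Here 960 · 2.5 = 2400, and the remaining 2n is less than 100 n L, so 50² suffices.
  have hT : ∫ ω, ‖B * A ω‖ ^ 2 ∂μ ≤ t ^ 2 := by
    rw [ht2]
    nlinarith [mul_le_mul_of_nonneg_right hpL (by linarith : (0 : ℝ) ≤ n),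
      mul_le_mul_of_nonneg_left hL0 (by linarith : (0 : ℝ) ≤ n)]
  have h : 2 * t * ∫ ω, ‖B * A ω‖ ∂μ ≤ ∫ ω, ‖B * A ω‖ ^ 2 ∂μ + t ^ 2 := by
    calc 2 * t * ∫ ω, ‖B * A ω‖ ∂μ = ∫ ω, 2 * t * ‖B * A ω‖ ∂μ := (integral_const_mul _ _).symm
      _ ≤ ∫ ω, (‖B * A ω‖ ^ 2 + t ^ 2) ∂μ :=
          integral_mono (hint.const_mul _) (hi.add (integrable_const _)) fun ω => by
            change 2 * t * ‖B * A ω‖ ≤ ‖B * A ω‖ ^ 2 + t ^ 2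
            nlinarith [sq_nonneg (‖B * A ω‖ - t)]
      _ = _ := by
          rw [integral_add hi (integrable_const _)]
          simp
  nlinarith
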